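/- Let $p\ge 3$ and consider $p$ particles held by $p$ parties, the $k$th one with a finite-dimensional Hilbert space $\mathcal H_k$. A W-type state is a normalized state vector that can be obtained with nonzero probability by LOCC from the standard W state $\frac1{\sqrt p}(|10\cdots0\rangle+|01\cdots0\rangle+\cdots+|00\cdots1\rangle)$, where $|0\rangle,|1\rangle$ are orthonormal vectors in each local space. Let $\mathcal S=\{\mathbf x\in\mathbb R^p : x_k\ge 0 \text{ for all } k,\ \sum_k x_k\le 1\}$ and, for $\mathbf x\in\mathcal S$, put $x_0=1-\sum_{k=1}^p x_k$. A state $\Psi$ has parameter vector $\mathbf x\in\mathcal S$ if there are orthonormal pairs $\alpha_k,\beta_k\in\mathcal H_k$ with $$\Psi=\sqrt{x_0}\,|\alpha_1\cdots\alpha_p\rangle+\sum_{k=1}^p\sqrt{x_k}\,|\alpha_1\cdots\alpha_{k-1}\beta_k\alpha_{k+1}\cdots\alpha_p\rangle .$$ For $\mathbf x,\mathbf x'\in\mathcal S$ write $\mathbf x\sim\mathbf x'$ if the $p$-qubit states $\sqrt{x_0}|0\cdots0\rangle+\sum_k\sqrt{x_k}|\mathbf 1_k\rangle$ and $\sqrt{x_0'}|0\cdots0\rangle+\sum_k\sqrt{x_k'}|\mathbf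 1_k\rangle$ are equivalent under local unitaries, where $\mathbf 1_k$ has a $1$ exactly at position $k$. Theorem. Let $\mathbf y\in\mathcal S$ and let $\Psi$ be a W-type state with parameter vector $\mathbf x$. Then $\Psi$ can be converted with certainty by LOCC (finitely many rounds, in each of which one party performs a generalized measurement with finitely many outcomes and announces the outcome) into a state with parameter vector $\mathbf y$ if and only if there is $\mathbf y'\in\mathcal S$ with $\mathbf y'\sim\mathbf y$ and $x_k\ge y'_k$ for all $k=1,\dots,p$. In particular, if at least three of $y_1,\dots,y_p$ are nonzero, then this conversion is possible if and only if $x_k\ge y_k$ for all $k=1,\dots,p$. -/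

import Mathlib

namespace WType

/-- (Unnormalized) pure state vectors of `p` particles, the `k`th one having Hilbert space `ℂ ^ (d k)`:
the coefficients in the product basis. -/
abbrev StateVec {p : ℕ} (d : Fin p → ℕ) : Type := (∀ k, Fin (d k)) → ℂ

/-- The vector is normalized. -/
def IsNormalized {p : ℕ} {d : Fin p → ℕ} (ψ : StateVec d) : Prop := ∑ i, ‖ψ i‖ ^ 2 = 1

/-- The operator `M` of party `k`, tensored with the identity of all other parties, applied to `ψ`. -/
def actAt {p : ℕ} {d : Fin p → ℕ} (k : Fin p) (M : Matrix (Fin (d k)) (Fin (d k)) ℂ)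
    (ψ : StateVec d) : StateVec d :=
  fun i => ∑ j : Fin (d k), M (i k) j * ψ (Function.update i k j)

/-- The product operator `A 1 ⊗ ⋯ ⊗ A p` applied to `ψ`. -/
def tensorAct {p : ℕ} {d : Fin p → ℕ} (A : ∀ k, Matrix (Fin (d k)) (Fin (d k)) ℂ)
    (ψ : StateVec d) : StateVec d :=
  fun i => ∑ j : ∀ k, Fin (d k), (∏ k, A k (i k) (j k)) * ψ j

/-- Equivalence under local unitary transformations. -/
def LUEquiv {p : ℕ} {d : Fin p → ℕ} (ψ φ : StateVec d) : Prop :=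
  ∃ U : ∀ k, Matrix (Fin (d k)) (Fin (d k)) ℂ,
    (∀ k, U k ∈ Matrix.unitaryGroup (Fin (d k)) ℂ) ∧ tensorAct U ψ = φ

/-- LOCC protocols: either stop, or let some party `k` carry out a generalized measurement with
finitely many outcomes and measurement operators `M r`, broadcast the outcome, and continue with a
protocol that depends on it. Local unitaries are measurements with a single outcome. -/
inductive Protocol {p : ℕ} (d : Fin p → ℕ) : Type
  | done : Protocol d
  | measure (k : Fin p) (n : ℕ) (M : Fin n → Matrix (Fin (d k)) (Fin (d k)) ℂ)
      (complete : ∑ r, (M r).conjTranspose * M r = 1) (next : Fin n → Protocol d) : Protocol d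

/-- The unnormalized final states over all sequences of outcomes of a protocol that starts in `ψ`.
The squared norm of such a vector is the probability of its sequence of outcomes; sequences of
probability zero give the zero vector. -/
def Protocol.finalStates {p : ℕ} {d : Fin p → ℕ} : Protocol d → StateVec d → Set (StateVec d)
  | .done, ψ => {ψ}
  | .measure k _ M _ next, ψ => ⋃ r, (next r).finalStates (actAt k (M r) ψ)

/-- `ψ` can be converted into the state `φ` by LOCC with certainty: for some protocol every
sequence of outcomes that has nonzero probability ends in `φ`, up to norm and phase. -/
def DetLOCC {p : ℕ} {d : Fin p → ℕ} (ψ φ : StateVec d) : Prop :=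
  ∃ P : Protocol d, ∀ χ ∈ P.finalStates ψ, ∃ c : ℂ, χ = c • φ

/-- `φ` is stochastically reducible from `ψ`: some LOCC protocol ends in `φ` with nonzero
probability. -/
def StochLOCC {p : ℕ} {d : Fin p → ℕ} (ψ φ : StateVec d) : Prop :=
  ∃ P : Protocol d, ∃ χ ∈ P.finalStates ψ, χ ≠ 0 ∧ ∃ c : ℂ, χ = c • φ

/-- The simplex of parameter vectors. -/
def paramSimplex (p : ℕ) : Set (Fin p → ℝ) := {x | (∀ k, 0 ≤ x k) ∧ ∑ k, x k ≤ 1}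

/-- The zeroth component of a parameter vector. -/
def zeroth {p : ℕ} (x : Fin p → ℝ) : ℝ := 1 - ∑ k, x k

/-- `α k, β k` is an orthonormal pair in the Hilbert space of party `k`, for every `k`. -/
def IsFrame {p : ℕ} {d : Fin p → ℕ} (α β : ∀ k, EuclideanSpace ℂ (Fin (d k))) : Prop :=
  ∀ k, ‖α k‖ = 1 ∧ ‖β k‖ = 1 ∧ inner ℂ (α k) (β k) = 0

/-- `√x₀ |α₁ ⋯ α_p⟩ + ∑ k, √x_k |α₁ ⋯ α_{k-1} β_k α_{k+1} ⋯ α_p⟩`. -/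
noncomputable def wVec {p : ℕ} {d : Fin p → ℕ} (x : Fin p → ℝ)
    (α β : ∀ k, EuclideanSpace ℂ (Fin (d k))) : StateVec d :=
  fun i => (Real.sqrt (zeroth x) : ℂ) * ∏ k, α k (i k) +
    ∑ k, (Real.sqrt (x k) : ℂ) * (β k (i k) * ∏ l ∈ Finset.univ.erase k, α l (i l))

/-- `ψ` is a W-type state: a normalized vector that is stochastically reducible by LOCC from the
standard W state `p^{-1/2} (|10⋯0⟩ + ⋯ + |0⋯01⟩)`, where `|0⟩, |1⟩` stand for an orthonormal pair
in each local Hilbert space. -/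
def IsWType {p : ℕ} {d : Fin p → ℕ} (ψ : StateVec d) : Prop :=
  IsNormalized ψ ∧ ∃ α β : ∀ k, EuclideanSpace ℂ (Fin (d k)), IsFrame α β ∧
    StochLOCC (wVec (fun _ => 1 / (p : ℝ)) α β) ψ

/-- `x` is a parameter vector of `ψ`. -/
def HasParam {p : ℕ} {d : Fin p → ℕ} (ψ : StateVec d) (x : Fin p → ℝ) : Prop :=
  x ∈ paramSimplex p ∧ ∃ α β : ∀ k, EuclideanSpace ℂ (Fin (d k)), IsFrame α β ∧ ψ = wVec x α β

/-- The representative `√x₀ |0⋯0⟩ + ∑ k, √x_k |0⋯1_k⋯0⟩` of `p` qubits. -/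
noncomputable def Phi {p : ℕ} (x : Fin p → ℝ) : StateVec (fun _ : Fin p => 2) :=
  wVec x (fun _ => EuclideanSpace.single 0 1) (fun _ => EuclideanSpace.single 1 1)

/-- Equivalence of parameter vectors: both lie in the simplex and their representatives are
equivalent under local unitaries. -/
def ParamEquiv {p : ℕ} (x x' : Fin p → ℝ) : Prop :=
  x ∈ paramSimplex p ∧ x' ∈ paramSimplex p ∧ LUEquiv (Phi x) (Phi x')

/-- `ψ` can be converted with certainty by LOCC into a state with parameter vector `y`. -/
def ConvertibleTo {p : ℕ} {d : Fin p → ℕ} (ψ : StateVec d) (y : Fin p → ℝ) : Prop :=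
  ∃ φ : StateVec d, HasParam φ y ∧ DetLOCC ψ φ

end WType

/-! Necessity. A local operator maps `tang c₀ a b` to a vector of the same form with the same `c₀`,
so every branch of a protocol that starts from a W vector stays in this family. For unnormalized
branch vectors, the weight of party `k` is the squared distance of `b k` from the line through `a
k`, times the squared norms of the other `a l`. Summed over the outcomes of a measurement, no weight
increases (`sum_weight_le`), while squared norms are conserved; on the initial state the weights are
`x`. The final vector itself determines the products of two distinct weights, through an
antisymmetrization of two copies (`pairInvariant_tang`). A branch ending in the target with squared
norm `N` thus has weights `v` with `v k * v l = N ^ 2 * (y k * y l)`. If three `y k` are nonzero,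
this forces `v k = N * y k`, and summing over branches gives `y k ≤ x k`. Otherwise `y` lives on two
parties `i, j`, and superadditivity of the geometric mean gives `y i * y j ≤ x i * x j`. Some `y' ≤
x` supported on `i, j` then has the same product as `y`; equal norm and determinant of the 2 × 2
coefficient matrices make `y'` and `y` equivalent (`exists_rotation`). Sufficiency. A two-outcome
measurement lowers one parameter, its two results differing only by local phases (`detLOCC_update`).
Equivalent parameter vectors describe the same states up to the choice of frame
(`ParamEquiv.exists_coordVec_eq`). -/

namespace WType

open Finset Function

variable {p : ℕ} {d d' d'' : Fin p → ℕ}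

/-! ### W-like vectors under local operators -/

/-- The product vector `v 1 ⊗ ⋯ ⊗ v p`. -/
def prodVec (v : ∀ k, Fin (d k) → ℂ) : StateVec d := fun i => ∏ k, v k (i k)

/-- The general W-like vector
`c₀ a₁ ⊗ ⋯ ⊗ a_p + ∑ n, a₁ ⊗ ⋯ ⊗ b_n ⊗ ⋯ ⊗ a_p`, for arbitrary local vectors. -/
def tang (c₀ : ℂ) (a b : ∀ k, Fin (d k) → ℂ) : StateVec d :=
  c₀ • prodVec a + ∑ n, prodVec (update a n (b n))

lemma prodVec_apply_eq (v : ∀ k, Fin (d k) → ℂ) (k : Fin p) (i : ∀ k, Fin (d k)) :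
    prodVec v i = v k (i k) * ∏ m ∈ univ.erase k, v m (i m) :=
  (mul_prod_erase univ (fun m => v m (i m)) (mem_univ k)).symm

lemma prodVec_update_apply (v : ∀ k, Fin (d k) → ℂ) (k : Fin p) (x : Fin (d k) → ℂ)
    (i : ∀ k, Fin (d k)) :
    prodVec (update v k x) i = x (i k) * ∏ m ∈ univ.erase k, v m (i m) := by
  rw [prodVec_apply_eq _ k, update_self]
  congr 1
  refine prod_congr rfl fun m hm => ?_
  rw [update_of_ne (ne_of_mem_erase hm)]

lemma prodVec_apply_update (v : ∀ k, Fin (d k) → ℂ) (k : Fin p) (s : Fin (d k))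
    (i : ∀ k, Fin (d k)) :
    prodVec v (update i k s) = v k s * ∏ m ∈ univ.erase k, v m (i m) := by
  rw [prodVec_apply_eq _ k, update_self]
  congr 1
  refine prod_congr rfl fun m hm => ?_
  rw [update_of_ne (ne_of_mem_erase hm)]

lemma prodVec_update_add (v : ∀ k, Fin (d k) → ℂ) (k : Fin p) (x y : Fin (d k) → ℂ) :
    prodVec (update v k (x + y)) = prodVec (update v k x) + prodVec (update v k y) := by
  funext i
  simp only [Pi.add_apply, prodVec_update_apply, add_mul]

lemma prodVec_update_smul (v : ∀ k, Fin (d k) → ℂ) (k : Fin p) (c : ℂ) (x : Fin (d k) → ℂ) :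
    prodVec (update v k (c • x)) = c • prodVec (update v k x) := by
  funext i
  simp only [Pi.smul_apply, prodVec_update_apply, smul_eq_mul, mul_assoc]

lemma actAt_add (k : Fin p) (M : Matrix (Fin (d k)) (Fin (d k)) ℂ) (ψ φ : StateVec d) :
    actAt k M (ψ + φ) = actAt k M ψ + actAt k M φ := by
  funext i
  simp [actAt, mul_add, sum_add_distrib]

lemma actAt_smul (k : Fin p) (M : Matrix (Fin (d k)) (Fin (d k)) ℂ) (c : ℂ) (ψ : StateVec d) :
    actAt k M (c • ψ) = c • actAt k M ψ := by
  funext i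
  simp [actAt, mul_sum, mul_left_comm]

lemma smul_actAt (k : Fin p) (M : Matrix (Fin (d k)) (Fin (d k)) ℂ) (c : ℂ) (ψ : StateVec d) :
    actAt k (c • M) ψ = c • actAt k M ψ := by
  funext i
  simp [actAt, mul_sum, mul_assoc]

lemma actAt_sum {ι : Type*} (s : Finset ι) (k : Fin p) (M : Matrix (Fin (d k)) (Fin (d k)) ℂ)
    (ψ : ι → StateVec d) : actAt k M (∑ n ∈ s, ψ n) = ∑ n ∈ s, actAt k M (ψ n) := by
  funext i
  simp only [actAt, Finset.sum_apply, mul_sum]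
  exact sum_comm

lemma actAt_prodVec (k : Fin p) (M : Matrix (Fin (d k)) (Fin (d k)) ℂ)
    (v : ∀ k, Fin (d k) → ℂ) :
    actAt k M (prodVec v) = prodVec (update v k (M.mulVec (v k))) := by
  funext i
  simp only [actAt, prodVec_update_apply, prodVec_apply_update, Matrix.mulVec, dotProduct, sum_mul,
    mul_assoc]

/-- No orthogonality of `a k` and `b k` is required, which is why the family is closed under
arbitrary measurement operators; `c₀` is never touched. -/
lemma actAt_tang (k : Fin p) (M : Matrix (Fin (d k)) (Fin (d k)) ℂ) (c₀ : ℂ)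
    (a b : ∀ k, Fin (d k) → ℂ) :
    actAt k M (tang c₀ a b) =
      tang c₀ (update a k (M.mulVec (a k))) (update b k (M.mulVec (b k))) := by
  rw [tang, actAt_add, actAt_smul, actAt_sum, tang, actAt_prodVec]
  congr 1
  refine sum_congr rfl fun n _ => ?_
  rw [actAt_prodVec]
  by_cases h : n = k
  · subst h
    simp
  · rw [update_of_ne (Ne.symm h), update_of_ne h, update_comm h]

/-- The tensor product of the (rectangular) matrices `A k`, applied to `ψ`. -/
def tmap (A : ∀ k, Matrix (Fin (d' k)) (Fin (d k)) ℂ) (ψ : StateVec d) : StateVec d' :=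
  fun i => ∑ j : ∀ k, Fin (d k), (∏ k, A k (i k) (j k)) * ψ j

lemma tmap_tmap (A : ∀ k, Matrix (Fin (d'' k)) (Fin (d' k)) ℂ)
    (B : ∀ k, Matrix (Fin (d' k)) (Fin (d k)) ℂ) (ψ : StateVec d) :
    tmap A (tmap B ψ) = tmap (fun k => A k * B k) ψ := by
  funext i
  simp only [tmap, mul_sum, Matrix.mul_apply]
  rw [sum_comm]
  refine sum_congr rfl fun j _ => ?_
  rw [Finset.prod_univ_sum, Fintype.piFinset_univ, sum_mul]
  refine sum_congr rfl fun l _ => ?_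
  rw [prod_mul_distrib, mul_assoc]

lemma tmap_one (ψ : StateVec d) : tmap (fun _ => 1) ψ = ψ := by
  funext i
  rw [tmap, sum_eq_single i]
  · simp
  · intro j _ hj
    obtain ⟨k, hk⟩ := Function.ne_iff.1 hj
    rw [prod_eq_zero (mem_univ k), zero_mul]
    exact Matrix.one_apply_ne hk.symm
  · simp

lemma tmap_prodVec (A : ∀ k, Matrix (Fin (d' k)) (Fin (d k)) ℂ) (v : ∀ k, Fin (d k) → ℂ) :
    tmap A (prodVec v) = prodVec fun k => (A k).mulVec (v k) := by
  funext i
  simp only [tmap, prodVec, Matrix.mulVec, dotProduct]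
  rw [Finset.prod_univ_sum, Fintype.piFinset_univ]
  exact sum_congr rfl fun j _ => prod_mul_distrib.symm

lemma tmap_tang (A : ∀ k, Matrix (Fin (d' k)) (Fin (d k)) ℂ) (c₀ : ℂ)
    (a b : ∀ k, Fin (d k) → ℂ) :
    tmap A (tang c₀ a b) = tang c₀ (fun k => (A k).mulVec (a k)) fun k => (A k).mulVec (b k) := by
  have hadd : ∀ ψ φ : StateVec d, tmap A (ψ + φ) = tmap A ψ + tmap A φ := fun ψ φ => by
    funext i; simp [tmap, mul_add, sum_add_distrib]
  have hsmul : ∀ (c : ℂ) (ψ : StateVec d), tmap A (c • ψ) = c • tmap A ψ := fun c ψ => by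
    funext i; simp [tmap, mul_sum, mul_left_comm]
  have hsum : ∀ ψ : Fin p → StateVec d, tmap A (∑ n, ψ n) = ∑ n, tmap A (ψ n) := fun ψ => by
    funext i
    simp only [tmap, Finset.sum_apply, mul_sum]
    exact sum_comm
  rw [tang, hadd, hsmul, hsum, tmap_prodVec, tang]
  congr 1
  refine sum_congr rfl fun n _ => ?_
  rw [tmap_prodVec]
  congr 1
  funext k
  by_cases h : k = n
  · subst h
    simp
  · simp [update_of_ne h]

lemma wVec_eq_tang (x : Fin p → ℝ) (α β : ∀ k, EuclideanSpace ℂ (Fin (d k))) :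
    wVec x α β = tang (Real.sqrt (zeroth x)) (fun k => α k)
      fun k => (Real.sqrt (x k) : ℂ) • (β k : Fin (d k) → ℂ) := by
  funext i
  simp only [wVec, tang, Pi.add_apply, Pi.smul_apply, Finset.sum_apply, smul_eq_mul,
    prodVec_update_apply, mul_assoc]
  rfl

/-! ### Gram determinants, weights and their behaviour under measurements -/

/-- The squared norm of a finite family of complex numbers. -/
noncomputable def nsq {ι : Type*} [Fintype ι] (v : ι → ℂ) : ℝ := ∑ i, ‖v i‖ ^ 2

/-- The Gram determinant of two vectors, as the squared norm of their exterior product. -/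
noncomputable def gram {n : ℕ} (a b : Fin n → ℂ) : ℝ :=
  (∑ s, ∑ t, ‖a s * b t - b s * a t‖ ^ 2) / 2

lemma nsq_nonneg {ι : Type*} [Fintype ι] (v : ι → ℂ) : 0 ≤ nsq v :=
  sum_nonneg fun _ _ => sq_nonneg _

lemma gram_nonneg {n : ℕ} (a b : Fin n → ℂ) : 0 ≤ gram a b := by
  unfold gram; positivity

lemma ofReal_nsq {ι : Type*} [Fintype ι] (v : ι → ℂ) : (nsq v : ℂ) = star v ⬝ᵥ v := by
  simp [nsq, dotProduct, Complex.conj_mul']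

lemma nsq_eq_zero {ι : Type*} [Fintype ι] {v : ι → ℂ} (h : nsq v = 0) : v = 0 := by
  funext i
  have := (sum_eq_zero_iff_of_nonneg (fun i _ => sq_nonneg ‖v i‖)).1 h i (mem_univ i)
  simpa using this

lemma nsq_smul {ι : Type*} [Fintype ι] (c : ℂ) (v : ι → ℂ) : nsq (c • v) = ‖c‖ ^ 2 * nsq v := by
  simp [nsq, mul_pow, mul_sum]

lemma gram_eq {n : ℕ} (a b : Fin n → ℂ) :
    gram a b = nsq a * nsq b - ‖star a ⬝ᵥ b‖ ^ 2 := by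
  have h : ((gram a b : ℝ) : ℂ) = ((nsq a * nsq b - ‖star a ⬝ᵥ b‖ ^ 2 : ℝ) : ℂ) := by
    have h1 : ((‖star a ⬝ᵥ b‖ ^ 2 : ℝ) : ℂ) = (star a ⬝ᵥ b) * (star b ⬝ᵥ a) := by
      push_cast
      rw [← Complex.mul_conj', Matrix.star_dotProduct]
      simp [dotProduct_comm]
    rw [Complex.ofReal_sub, h1, Complex.ofReal_mul, ofReal_nsq, ofReal_nsq, gram]
    simp only [dotProduct, sum_mul_sum]
    push_cast
    rw [div_eq_iff two_ne_zero, sub_mul, mul_two, mul_two]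
    have hsymm : ∀ f : Fin n → Fin n → ℂ,
        ∑ s, ∑ t, f s t + ∑ s, ∑ t, f s t = ∑ s, ∑ t, (f s t + f t s) := fun f => by
      simp only [sum_add_distrib]
      congr 1
      exact sum_comm
    rw [hsymm, hsymm, ← sum_sub_distrib]
    simp only [← sum_sub_distrib]
    refine sum_congr rfl fun s _ => sum_congr rfl fun t _ => ?_
    rw [← Complex.mul_conj']
    simp only [Pi.star_apply, RCLike.star_def, map_sub, map_mul]
    ring
  exact_mod_cast h

lemma gram_sub_smul {n : ℕ} (a b : Fin n → ℂ) (t : ℂ) : gram a (b - t • a) = gram a b := by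
  unfold gram
  congr 1
  refine sum_congr rfl fun s _ => sum_congr rfl fun t _ => ?_
  congr 2
  simp only [Pi.sub_apply, Pi.smul_apply, smul_eq_mul]
  ring

lemma gram_le {n : ℕ} (a b : Fin n → ℂ) : gram a b ≤ nsq a * nsq b := by
  rw [gram_eq]
  nlinarith [sq_nonneg ‖star a ⬝ᵥ b‖]

/-- The weight of party `k` in `tang c₀ a b`: the squared distance of `b k` from the line through
`a k`, times the squared norms of the other `a l`. -/
noncomputable def weight (a b : ∀ k, Fin (d k) → ℂ) (k : Fin p) : ℝ :=
  gram (a k) (b k) / nsq (a k) * ∏ l ∈ univ.erase k, nsq (a l)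

lemma weight_nonneg (a b : ∀ k, Fin (d k) → ℂ) (k : Fin p) : 0 ≤ weight a b k :=
  mul_nonneg (div_nonneg (gram_nonneg _ _) (nsq_nonneg _)) (prod_nonneg fun _ _ => nsq_nonneg _)

/-- The squared norms of `a k` and `a l` in the denominators cancel against the complementary
products. -/
lemma weight_mul_weight (a b : ∀ k, Fin (d k) → ℂ) {k l : Fin p} (hkl : k ≠ l) :
    weight a b k * weight a b l =
      gram (a k) (b k) * gram (a l) (b l) * (∏ m ∈ (univ.erase k).erase l, nsq (a m)) ^ 2 := by
  -- When `a k = 0` the quotient is zero by convention, but then the Gram determinant vanishes too.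
  have key : ∀ k, gram (a k) (b k) / nsq (a k) * nsq (a k) = gram (a k) (b k) := fun k => by
    by_cases h : nsq (a k) = 0
    · have h1 := gram_le (a k) (b k)
      have h2 := gram_nonneg (a k) (b k)
      rw [h, zero_mul] at h1
      rw [h, mul_zero, le_antisymm h1 h2]
    · exact div_mul_cancel₀ _ h
  have h1 : ∏ m ∈ univ.erase k, nsq (a m) = nsq (a l) * ∏ m ∈ (univ.erase k).erase l, nsq (a m) :=
    (mul_prod_erase _ (fun m => nsq (a m)) (mem_erase.2 ⟨hkl.symm, mem_univ l⟩)).symm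
  have h2 : ∏ m ∈ univ.erase l, nsq (a m) = nsq (a k) * ∏ m ∈ (univ.erase k).erase l, nsq (a m) := by
    rw [erase_right_comm]
    exact (mul_prod_erase _ (fun m => nsq (a m)) (mem_erase.2 ⟨hkl, mem_univ k⟩)).symm
  rw [weight, weight, h1, h2, ← key k, ← key l]
  ring_nf
  by_cases hk : nsq (a k) = 0
  · simp [hk]
  by_cases hl : nsq (a l) = 0
  · simp [hl]
  field_simp

lemma sum_nsq_mulVec {n N : ℕ} {M : Fin N → Matrix (Fin n) (Fin n) ℂ}
    (hM : ∑ r, (M r).conjTranspose * M r = 1) (v : Fin n → ℂ) :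
    ∑ r, nsq ((M r).mulVec v) = nsq v := by
  have h : ((∑ r, nsq ((M r).mulVec v) : ℝ) : ℂ) = (nsq v : ℂ) := by
    push_cast
    simp only [ofReal_nsq]
    calc ∑ r, star ((M r).mulVec v) ⬝ᵥ (M r).mulVec v
        = ∑ r, star v ⬝ᵥ ((M r).conjTranspose * M r).mulVec v := by
          refine sum_congr rfl fun r _ => ?_
          rw [Matrix.star_mulVec, ← Matrix.dotProduct_mulVec, Matrix.mulVec_mulVec]
      _ = star v ⬝ᵥ v := by
          rw [← dotProduct_sum, ← Matrix.sum_mulVec, hM, Matrix.one_mulVec]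
  exact_mod_cast h

/-- The operators act on the index of party `k` alone, so the one-party identity applies for each
fixed value of the other indices. -/
lemma sum_nsq_actAt {k : Fin p} {N : ℕ} {M : Fin N → Matrix (Fin (d k)) (Fin (d k)) ℂ}
    (hM : ∑ r, (M r).conjTranspose * M r = 1) (ψ : StateVec d) :
    ∑ r, nsq (actAt k (M r) ψ) = nsq ψ := by
  let e := Equiv.piSplitAt k fun k => Fin (d k)
  have hsplit : ∀ φ : StateVec d, nsq φ = ∑ y, nsq fun t => φ (e.symm (t, y)) := fun φ => by
    rw [nsq, ← e.symm.sum_comp, Fintype.sum_prod_type_right]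
    rfl
  have hact : ∀ r y, (fun t => actAt k (M r) ψ (e.symm (t, y))) =
      (M r).mulVec fun t => ψ (e.symm (t, y)) := fun r y => by
    funext s
    simp only [actAt, Matrix.mulVec, dotProduct]
    refine sum_congr rfl fun t _ => ?_
    have h1 : e.symm (s, y) k = s := by simp [e]
    have h2 : update (e.symm (s, y)) k t = e.symm (t, y) := by
      funext m
      by_cases hm : m = k
      · subst hm
        simp [e]
      · simp [e, hm]
    rw [h1, h2]
  simp only [hsplit, hact]
  rw [sum_comm]
  exact sum_congr rfl fun y _ => sum_nsq_mulVec hM _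

/-- Replacing `b` by its component orthogonal to `a` changes no Gram determinant. The right side
becomes the squared norm of this component, which the measurement conserves in total, and each
outcome contributes at most its share because `gram` is bounded by the product of the squared norms.
-/
lemma sum_gram_div_le {n N : ℕ} {M : Fin N → Matrix (Fin n) (Fin n) ℂ}
    (hM : ∑ r, (M r).conjTranspose * M r = 1) (a b : Fin n → ℂ) :
    ∑ r, gram ((M r).mulVec a) ((M r).mulVec b) / nsq ((M r).mulVec a) ≤ gram a b / nsq a := by
  by_cases ha : nsq a = 0
  · rw [nsq_eq_zero ha]
    simp [nsq]
  set t : ℂ := (star a ⬝ᵥ b) / nsq a with ht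
  have horth : star a ⬝ᵥ (b - t • a) = 0 := by
    have : (nsq a : ℂ) ≠ 0 := by exact_mod_cast ha
    rw [dotProduct_sub, dotProduct_smul, ← ofReal_nsq, ht, smul_eq_mul, div_mul_cancel₀ _ this,
      sub_self]
  have h1 : gram a b / nsq a = nsq (b - t • a) := by
    rw [← gram_sub_smul a b t, gram_eq, horth]
    simp [mul_div_cancel_left₀ _ ha]
  rw [h1, ← sum_nsq_mulVec hM]
  refine sum_le_sum fun r _ => ?_
  rw [← gram_sub_smul _ _ t, ← Matrix.mulVec_smul, ← Matrix.mulVec_sub]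
  refine div_le_of_le_mul₀ (nsq_nonneg _) (nsq_nonneg _) ?_
  rw [mul_comm]
  exact gram_le _ _

/-- The weights of a W-like vector do not increase on average under a measurement. -/
lemma sum_weight_le {k : Fin p} {N : ℕ} {M : Fin N → Matrix (Fin (d k)) (Fin (d k)) ℂ}
    (hM : ∑ r, (M r).conjTranspose * M r = 1) (a b : ∀ k, Fin (d k) → ℂ) (l : Fin p) :
    ∑ r, weight (update a k ((M r).mulVec (a k))) (update b k ((M r).mulVec (b k))) l ≤
      weight a b l := by
  by_cases h : l = k
  · subst h
    have h1 : ∀ r, ∏ m ∈ univ.erase l, nsq (update a l ((M r).mulVec (a l)) m) =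
        ∏ m ∈ univ.erase l, nsq (a m) := fun r =>
      prod_congr rfl fun m hm => by rw [update_of_ne (ne_of_mem_erase hm)]
    simp only [weight, h1, update_self, ← sum_mul]
    exact mul_le_mul_of_nonneg_right (sum_gram_div_le hM _ _) (prod_nonneg fun _ _ => nsq_nonneg _)
  -- The measured party enters the weight of `l ≠ k` only through the factor `nsq (a k)`, so here
  -- the sum is conserved exactly.
  · have hk : k ∈ univ.erase l := mem_erase.2 ⟨Ne.symm h, mem_univ k⟩
    have h1 : ∀ r, ∏ m ∈ univ.erase l, nsq (update a k ((M r).mulVec (a k)) m) =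
        nsq ((M r).mulVec (a k)) * ∏ m ∈ (univ.erase l).erase k, nsq (a m) := fun r => by
      rw [← mul_prod_erase _ _ hk, update_self]
      congr 1
      exact prod_congr rfl fun m hm => by rw [update_of_ne (ne_of_mem_erase hm)]
    simp only [weight, h1, update_of_ne h]
    rw [← mul_sum, ← sum_mul, sum_nsq_mulVec hM, mul_prod_erase _ (fun m => nsq (a m)) hk]

/-! ### The pair invariant -/

/-- Two copies of `ψ`, antisymmetrized with respect to the swaps of the particles `k` and `l`. -/
def antisymm (k l : Fin p) (ψ : StateVec d) (i j : ∀ k, Fin (d k)) : ℂ :=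
  ψ (update (update i k (i k)) l (i l)) * ψ (update (update j k (j k)) l (j l)) -
  ψ (update (update i k (j k)) l (i l)) * ψ (update (update j k (i k)) l (j l)) -
  ψ (update (update i k (i k)) l (j l)) * ψ (update (update j k (j k)) l (i l)) +
  ψ (update (update i k (j k)) l (j l)) * ψ (update (update j k (i k)) l (i l))

/-- The squared concurrence of the particles `k` and `l`, up to a constant. -/
noncomputable def pairInvariant (k l : Fin p) (ψ : StateVec d) : ℝ :=
  ∑ i, ∑ j, ‖antisymm k l ψ i j‖ ^ 2

lemma pairInvariant_smul (k l : Fin p) (c : ℂ) (ψ : StateVec d) :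
    pairInvariant k l (c • ψ) = (‖c‖ ^ 2) ^ 2 * pairInvariant k l ψ := by
  simp only [pairInvariant, mul_sum]
  refine sum_congr rfl fun i _ => sum_congr rfl fun j _ => ?_
  have : antisymm k l (c • ψ) i j = c ^ 2 * antisymm k l ψ i j := by
    simp only [antisymm, Pi.smul_apply, smul_eq_mul]
    ring
  rw [this, norm_mul, norm_pow, mul_pow]

lemma prodVec_update_update {k l : Fin p} (hkl : k ≠ l) (v : ∀ k, Fin (d k) → ℂ)
    (i : ∀ k, Fin (d k)) (s : Fin (d k)) (t : Fin (d l)) :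
    prodVec v (update (update i k s) l t) =
      v k s * v l t * ∏ m ∈ (univ.erase k).erase l, v m (i m) := by
  rw [prodVec_apply_update, ← mul_prod_erase _ _ (mem_erase.2 ⟨hkl, mem_univ k⟩), update_self,
    erase_right_comm, ← mul_assoc, mul_comm (v l t)]
  congr 1
  refine prod_congr rfl fun m hm => ?_
  rw [update_of_ne (ne_of_mem_erase (mem_of_mem_erase hm))]

/-- Every term whose `b` sits outside `k, l` is proportional to the product of `a k` and `a l`;
these terms and the `c₀` term are collected in `R`. -/
lemma tang_update_update {k l : Fin p} (hkl : k ≠ l) (c₀ : ℂ) (a b : ∀ k, Fin (d k) → ℂ)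
    (i : ∀ k, Fin (d k)) :
    ∃ R : ℂ, ∀ s t, tang c₀ a b (update (update i k s) l t) =
      R * a k s * a l t +
        (∏ m ∈ (univ.erase k).erase l, a m (i m)) * (b k s * a l t + a k s * b l t) := by
  set S := (univ.erase k).erase l
  refine ⟨c₀ * ∏ m ∈ S, a m (i m) + ∑ n ∈ S, ∏ m ∈ S, update a n (b n) m (i m), fun s t => ?_⟩
  have hl : l ∈ univ.erase k := mem_erase.2 ⟨hkl.symm, mem_univ l⟩
  simp only [tang, Pi.add_apply, Pi.smul_apply, Finset.sum_apply, smul_eq_mul,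
    prodVec_update_update hkl]
  rw [← add_sum_erase _ _ (mem_univ k), ← add_sum_erase _ _ hl]
  have h1 : ∏ m ∈ S, update a k (b k) m (i m) = ∏ m ∈ S, a m (i m) :=
    prod_congr rfl fun m hm => by rw [update_of_ne (ne_of_mem_erase (mem_of_mem_erase hm))]
  have h2 : ∏ m ∈ S, update a l (b l) m (i m) = ∏ m ∈ S, a m (i m) :=
    prod_congr rfl fun m hm => by rw [update_of_ne (ne_of_mem_erase hm)]
  have h3 : ∑ n ∈ S, update a n (b n) k s * update a n (b n) l t *
      ∏ m ∈ S, update a n (b n) m (i m) =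
      a k s * a l t * ∑ n ∈ S, ∏ m ∈ S, update a n (b n) m (i m) := by
    rw [mul_sum]
    refine sum_congr rfl fun n hn => ?_
    rw [update_of_ne (ne_of_mem_erase (mem_of_mem_erase hn)).symm,
      update_of_ne (ne_of_mem_erase hn).symm]
  rw [h1, h2, h3, update_self, update_self, update_of_ne hkl, update_of_ne hkl.symm]
  ring

/-- Antisymmetrization removes `R`, leaving a product of a 2 × 2 minor at `k` and one at `l`. -/
lemma antisymm_tang {k l : Fin p} (hkl : k ≠ l) (c₀ : ℂ) (a b : ∀ k, Fin (d k) → ℂ)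
    (i j : ∀ k, Fin (d k)) :
    antisymm k l (tang c₀ a b) i j =
      -2 * (a k (i k) * b k (j k) - b k (i k) * a k (j k)) *
        (a l (i l) * b l (j l) - b l (i l) * a l (j l)) *
        ∏ m ∈ (univ.erase k).erase l, a m (i m) * a m (j m) := by
  obtain ⟨R, hR⟩ := tang_update_update hkl c₀ a b i
  obtain ⟨R', hR'⟩ := tang_update_update hkl c₀ a b j
  simp only [antisymm, hR, hR', prod_mul_distrib]
  ring

lemma sum_sum_prod (f : ∀ k, Fin (d k) → Fin (d k) → ℝ) :
    ∑ i : ∀ k, Fin (d k), ∑ j : ∀ k, Fin (d k), ∏ m, f m (i m) (j m) =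
      ∏ m, ∑ s, ∑ t, f m s t := by
  rw [Finset.prod_univ_sum, Fintype.piFinset_univ]
  refine sum_congr rfl fun i _ => ?_
  rw [Finset.prod_univ_sum, Fintype.piFinset_univ]

/-- The left side depends on the vector only, so the product of weights does not depend on the
choice of `c₀, a, b`. The constant is the square of the factor `-2` times the two halves in the
definition of `gram`. -/
lemma pairInvariant_tang {k l : Fin p} (hkl : k ≠ l) (c₀ : ℂ) (a b : ∀ k, Fin (d k) → ℂ) :
    pairInvariant k l (tang c₀ a b) = 16 * (weight a b k * weight a b l) := by
  have hl : l ∈ univ.erase k := mem_erase.2 ⟨hkl.symm, mem_univ l⟩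
  let f : ∀ m, Fin (d m) → Fin (d m) → ℝ := fun m s t =>
    if m = k ∨ m = l then ‖a m s * b m t - b m s * a m t‖ ^ 2 else ‖a m s‖ ^ 2 * ‖a m t‖ ^ 2
  have hS : ∀ m ∈ (univ.erase k).erase l, ¬ (m = k ∨ m = l) := fun m hm => by
    simp only [mem_erase, mem_univ] at hm
    tauto
  have h1 : pairInvariant k l (tang c₀ a b) = 4 * ∏ m, ∑ s, ∑ t, f m s t := by
    rw [← sum_sum_prod, pairInvariant, mul_sum]
    refine sum_congr rfl fun i _ => ?_
    rw [mul_sum]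
    refine sum_congr rfl fun j _ => ?_
    rw [antisymm_tang hkl, ← mul_prod_erase _ _ (mem_univ k), ← mul_prod_erase _ _ hl]
    have h2 : ∏ m ∈ (univ.erase k).erase l, f m (i m) (j m) =
        ‖∏ m ∈ (univ.erase k).erase l, a m (i m) * a m (j m)‖ ^ 2 := by
      rw [norm_prod, ← prod_pow]
      refine prod_congr rfl fun m hm => ?_
      simp only [f, hS m hm, if_false, norm_mul, mul_pow]
    rw [h2]
    simp only [f, true_or, or_true, if_true, norm_mul, norm_neg, mul_pow, Complex.norm_ofNat]
    ring
  have h3 : ∏ m ∈ (univ.erase k).erase l, ∑ s, ∑ t, f m s t =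
      (∏ m ∈ (univ.erase k).erase l, nsq (a m)) ^ 2 := by
    rw [← prod_pow]
    refine prod_congr rfl fun m hm => ?_
    simp only [f, hS m hm, if_false, nsq, sq, sum_mul_sum]
  rw [h1, weight_mul_weight a b hkl, ← mul_prod_erase _ _ (mem_univ k), ← mul_prod_erase _ _ hl, h3]
  simp only [f, true_or, or_true, if_true, gram]
  ring

/-! ### W vectors over orthonormal frames -/

lemma dotProduct_prodVec (u v : ∀ k, Fin (d k) → ℂ) :
    star (prodVec u) ⬝ᵥ prodVec v = ∏ k, star (u k) ⬝ᵥ v k := by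
  simp only [dotProduct]
  rw [Finset.prod_univ_sum, Fintype.piFinset_univ]
  refine sum_congr rfl fun i _ => ?_
  simp [prodVec, prod_mul_distrib]

/-- `a k, b k` is an orthonormal pair for every `k`; coordinate version of `IsFrame`. -/
def IsCoordFrame (a b : ∀ k, Fin (d k) → ℂ) : Prop :=
  ∀ k, nsq (a k) = 1 ∧ nsq (b k) = 1 ∧ star (a k) ⬝ᵥ b k = 0

/-- Coordinate version of `wVec`. -/
noncomputable def coordVec (x : Fin p → ℝ) (a b : ∀ k, Fin (d k) → ℂ) : StateVec d :=
  tang (Real.sqrt (zeroth x)) a fun k => (Real.sqrt (x k) : ℂ) • b k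

lemma norm_eq_one_iff {n : ℕ} (v : EuclideanSpace ℂ (Fin n)) : ‖v‖ = 1 ↔ nsq v = 1 := by
  rw [nsq, ← EuclideanSpace.norm_sq_eq, pow_eq_one_iff_of_nonneg (norm_nonneg v) two_ne_zero]

lemma isFrame_iff (α β : ∀ k, EuclideanSpace ℂ (Fin (d k))) :
    IsFrame α β ↔ IsCoordFrame (fun k => α k) fun k => β k := by
  simp only [IsFrame, IsCoordFrame, norm_eq_one_iff, EuclideanSpace.inner_eq_star_dotProduct,
    dotProduct_comm]

lemma hasParam_iff (ψ : StateVec d) (x : Fin p → ℝ) :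
    HasParam ψ x ↔ x ∈ paramSimplex p ∧ ∃ a b, IsCoordFrame a b ∧ ψ = coordVec x a b := by
  refine and_congr_right fun _ => ⟨?_, ?_⟩
  · rintro ⟨α, β, h, rfl⟩
    exact ⟨_, _, (isFrame_iff α β).1 h, wVec_eq_tang x α β⟩
  · rintro ⟨a, b, h, rfl⟩
    exact ⟨fun k => WithLp.toLp 2 (a k), fun k => WithLp.toLp 2 (b k), (isFrame_iff _ _).2 h,
      (wVec_eq_tang _ _ _).symm⟩

lemma zeroth_nonneg {x : Fin p → ℝ} (hx : x ∈ paramSimplex p) : 0 ≤ zeroth x :=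
  sub_nonneg.2 hx.2

lemma IsCoordFrame.star_dotProduct_eq {a b : ∀ k, Fin (d k) → ℂ} (h : IsCoordFrame a b)
    (k : Fin p) : star (a k) ⬝ᵥ a k = 1 ∧ star (b k) ⬝ᵥ b k = 1 ∧ star (a k) ⬝ᵥ b k = 0 ∧
      star (b k) ⬝ᵥ a k = 0 := by
  obtain ⟨h1, h2, h3⟩ := h k
  refine ⟨?_, ?_, h3, ?_⟩
  · rw [← ofReal_nsq, h1, Complex.ofReal_one]
  · rw [← ofReal_nsq, h2, Complex.ofReal_one]
  · rw [Matrix.star_dotProduct, h3, star_zero]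

lemma weight_frame {x : Fin p → ℝ} (hx : x ∈ paramSimplex p) {a b : ∀ k, Fin (d k) → ℂ}
    (h : IsCoordFrame a b) : weight a (fun k => (Real.sqrt (x k) : ℂ) • b k) = x := by
  funext k
  obtain ⟨h1, h2, h3⟩ := h k
  rw [weight, prod_eq_one fun l _ => (h l).1, gram_eq, dotProduct_smul, h3, nsq_smul, h1, h2,
    Complex.norm_real, Real.norm_eq_abs, sq_abs, Real.sq_sqrt (hx.1 k)]
  simp

lemma nsq_coordVec {x : Fin p → ℝ} (hx : x ∈ paramSimplex p) {a b : ∀ k, Fin (d k) → ℂ}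
    (h : IsCoordFrame a b) : nsq (coordVec x a b) = 1 := by
  -- The product vectors are indexed by the position of `b`, with `none` for no `b`. Two distinct
  -- ones disagree at some party, where `a k` meets `b k`, so they are orthogonal.
  let u : Option (Fin p) → ∀ k, Fin (d k) → ℂ := fun o k => if o = some k then b k else a k
  let w : Option (Fin p) → ℝ := fun o => o.elim (zeroth x) x
  have hw : ∀ o, 0 ≤ w o := fun o => by
    cases o
    · exact zeroth_nonneg hx
    · exact hx.1 _
  have hu : coordVec x a b = ∑ o, (Real.sqrt (w o) : ℂ) • prodVec (u o) := by
    rw [Fintype.sum_option, coordVec, tang]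
    congr 1
    refine sum_congr rfl fun n _ => ?_
    rw [prodVec_update_smul]
    congr 2
    funext k
    by_cases hk : k = n
    · subst hk
      simp [u]
    · simp [u, hk, Ne.symm hk]
  have horth : ∀ o o', star (prodVec (u o)) ⬝ᵥ prodVec (u o') = if o = o' then 1 else 0 := by
    intro o o'
    rw [dotProduct_prodVec]
    split_ifs with ho
    · subst ho
      refine prod_eq_one fun k _ => ?_
      simp only [u]
      split_ifs
      · exact (h.star_dotProduct_eq k).2.1
      · exact (h.star_dotProduct_eq k).1
    · obtain ⟨k, hk⟩ : ∃ k, ¬(o = some k ↔ o' = some k) := by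
        by_contra! hc
        exact ho (Option.ext fun k => hc k)
      refine prod_eq_zero (mem_univ k) ?_
      simp only [u]
      split_ifs
      · tauto
      · exact (h.star_dotProduct_eq k).2.2.2
      · exact (h.star_dotProduct_eq k).2.2.1
      · tauto
  have hc : ((nsq (coordVec x a b) : ℝ) : ℂ) = ((∑ o, w o : ℝ) : ℂ) := by
    rw [ofReal_nsq, hu, star_sum, sum_dotProduct]
    push_cast
    refine sum_congr rfl fun o _ => ?_
    rw [dotProduct_sum, sum_eq_single o]
    · rw [star_smul, smul_dotProduct, dotProduct_smul, horth, if_pos rfl, smul_eq_mul,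
        smul_eq_mul, mul_one, RCLike.star_def, Complex.conj_ofReal, ← Complex.ofReal_mul,
        Real.mul_self_sqrt (hw o)]
    · intro o' _ ho
      rw [star_smul, smul_dotProduct, dotProduct_smul, horth, if_neg ho.symm]
      simp
    · simp
  rw [Complex.ofReal_inj] at hc
  rw [hc, Fintype.sum_option]
  simp [w, zeroth]

/-! ### Necessity: constraints carried back through a protocol -/

/-- A predicate on (squared norm, weights) that is additive, upward closed in the weights and holds
at the end of all branches of a protocol also holds at its beginning. -/
lemma Protocol.induction_weight (S : ℝ → (Fin p → ℝ) → Prop) (h0 : S 0 0)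
    (hadd : ∀ {N v N' v'}, S N v → S N' v' → S (N + N') (v + v'))
    (hup : ∀ {N v v'}, S N v → v ≤ v' → S N v') (c₀ : ℂ) (P : Protocol d) :
    ∀ a b : ∀ k, Fin (d k) → ℂ,
      (∀ a' b', tang c₀ a' b' ∈ P.finalStates (tang c₀ a b) →
        S (nsq (tang c₀ a' b')) (weight a' b')) →
      S (nsq (tang c₀ a b)) (weight a b) := by
  induction P with
  | done => exact fun a b h => h a b rfl
  | measure k n M hM next ih =>
    intro a b h
    have hr : ∀ r, S (nsq (actAt k (M r) (tang c₀ a b)))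
        (weight (update a k ((M r).mulVec (a k))) (update b k ((M r).mulVec (b k)))) := by
      intro r
      rw [actAt_tang]
      refine ih r _ _ fun a' b' hab => h a' b' ?_
      rw [Protocol.finalStates, Set.mem_iUnion]
      exact ⟨r, by rwa [actAt_tang]⟩
    have hsum : ∀ s : Finset (Fin n), S (∑ r ∈ s, nsq (actAt k (M r) (tang c₀ a b)))
        (∑ r ∈ s, weight (update a k ((M r).mulVec (a k))) (update b k ((M r).mulVec (b k)))) := by
      intro s
      induction s using Finset.induction_on with
      | empty => simpa using h0
      | insert r s hs hS =>
        rw [sum_insert hs, sum_insert hs]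
        exact hadd (hr r) hS
    rw [← sum_nsq_actAt hM]
    refine hup (hsum univ) fun l => ?_
    rw [Finset.sum_apply]
    exact sum_weight_le hM a b l

/-- In a deterministic conversion, such a predicate only has to be checked on weights with the same
pairwise products as those of the target. -/
lemma DetLOCC.induction_weight {x y : Fin p → ℝ} (hx : x ∈ paramSimplex p)
    (hy : y ∈ paramSimplex p) {a b a' b' : ∀ k, Fin (d k) → ℂ} (h : IsCoordFrame a b)
    (h' : IsCoordFrame a' b') (hconv : DetLOCC (coordVec x a b) (coordVec y a' b'))
    (S : ℝ → (Fin p → ℝ) → Prop)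
    (hadd : ∀ {N v N' v'}, S N v → S N' v' → S (N + N') (v + v'))
    (hup : ∀ {N v v'}, S N v → v ≤ v' → S N v')
    (hS : ∀ N v, 0 ≤ N → 0 ≤ v → (∀ k l, k ≠ l → v k * v l = N ^ 2 * (y k * y l)) → S N v) :
    S 1 x := by
  obtain ⟨P, hP⟩ := hconv
  suffices key : S (nsq (coordVec x a b)) (weight a fun k => (Real.sqrt (x k) : ℂ) • b k) by
    rwa [nsq_coordVec hx h, weight_frame hx h] at key
  refine P.induction_weight S (hS 0 0 le_rfl le_rfl fun k l _ => by simp) hadd hup _ _ _ ?_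
  -- The local vectors of a branch need not resemble the target frame; only the pair invariant,
  -- computed from both presentations of one vector, relates the weights.
  intro u v huv
  obtain ⟨c, hc⟩ := hP _ huv
  refine hS _ _ (nsq_nonneg _) (fun k => weight_nonneg _ _ k) fun k l hkl => ?_
  have h1 := pairInvariant_tang hkl (Real.sqrt (zeroth x)) u v
  have h2 := pairInvariant_tang hkl (Real.sqrt (zeroth y)) a' fun k => (Real.sqrt (y k) : ℂ) • b' k
  rw [weight_frame hy h'] at h2
  rw [hc, pairInvariant_smul, coordVec, h2] at h1
  rw [hc, nsq_smul, nsq_coordVec hy h']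
  linarith

lemma exists_pair_of_card_filter_lt {p : ℕ} (hp : 3 ≤ p) {y : Fin p → ℝ}
    (h : ¬ 3 ≤ (univ.filter fun k => y k ≠ 0).card) :
    ∃ i j, i ≠ j ∧ ∀ k, k ≠ i → k ≠ j → y k = 0 := by
  obtain ⟨t, ht, hcard⟩ := exists_superset_card_eq (s := univ.filter fun k => y k ≠ 0) (n := 2)
    (by omega) (by simpa using by omega)
  obtain ⟨i, j, hij, rfl⟩ := card_eq_two.1 hcard
  refine ⟨i, j, hij, fun k hi hj => ?_⟩
  by_contra hk
  have := ht (mem_filter.2 ⟨mem_univ k, hk⟩)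
  simp [hi, hj] at this

lemma exists_two_others {y : Fin p → ℝ} (h : 3 ≤ (univ.filter fun k => y k ≠ 0).card) (k : Fin p) :
    ∃ l m, l ≠ k ∧ m ≠ k ∧ l ≠ m ∧ y l ≠ 0 ∧ y m ≠ 0 := by
  have : 1 < ((univ.filter fun k => y k ≠ 0).erase k).card :=
    lt_of_lt_of_le (by omega) pred_card_le_card_erase
  obtain ⟨l, hl, m, hm, hlm⟩ := one_lt_card.1 this
  simp only [mem_erase, mem_filter, mem_univ, true_and] at hl hm
  exact ⟨l, m, hl.1, hm.1, hlm, hl.2, hm.2⟩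

/-- With `y l` and `y m` nonzero, `v k ^ 2` is `(v k * v l) * (v k * v m)` divided by `v l * v m`,
so the pairwise products determine `v k`. -/
lemma le_of_detLOCC {x y : Fin p → ℝ} (hx : x ∈ paramSimplex p)
    (hy : y ∈ paramSimplex p) {a b a' b' : ∀ k, Fin (d k) → ℂ} (h : IsCoordFrame a b)
    (h' : IsCoordFrame a' b') (hconv : DetLOCC (coordVec x a b) (coordVec y a' b'))
    (hcard : 3 ≤ (univ.filter fun k => y k ≠ 0).card) (k : Fin p) : y k ≤ x k := by
  obtain ⟨l, m, hl, hm, hlm, hyl, hym⟩ := exists_two_others hcard k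
  have := hconv.induction_weight hx hy h h' (fun N v => N * y k ≤ v k)
    (fun h1 h2 => by simpa only [add_mul, Pi.add_apply] using add_le_add h1 h2)
    (fun h1 h2 => h1.trans (h2 k)) ?_
  · simpa using this
  intro N v hN hv hprod
  rcases hN.eq_or_lt with rfl | hN
  · simpa using hv k
  have hl0 : 0 < y l := lt_of_le_of_ne (hy.1 l) hyl.symm
  have hm0 : 0 < y m := lt_of_le_of_ne (hy.1 m) hym.symm
  have h1 := hprod k l hl.symm
  have h2 := hprod k m hm.symm
  have h3 := hprod l m hlm
  have h4 : 0 < N ^ 2 * (y l * y m) := by positivity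
  have h5 : v k ^ 2 * (N ^ 2 * (y l * y m)) = (N * y k) ^ 2 * (N ^ 2 * (y l * y m)) := by
    calc v k ^ 2 * (N ^ 2 * (y l * y m)) = (v k * v l) * (v k * v m) := by rw [← h3]; ring
      _ = _ := by rw [h1, h2]; ring
  exact (abs_le_of_sq_le_sq' (mul_right_cancel₀ h4.ne' h5).ge (hv k)).2

lemma mul_le_mul_of_detLOCC {x y : Fin p → ℝ} (hx : x ∈ paramSimplex p)
    (hy : y ∈ paramSimplex p) {a b a' b' : ∀ k, Fin (d k) → ℂ} (h : IsCoordFrame a b)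
    (h' : IsCoordFrame a' b') (hconv : DetLOCC (coordVec x a b) (coordVec y a' b'))
    {i j : Fin p} (hij : i ≠ j) : y i * y j ≤ x i * x j := by
  set q := y i * y j with hq
  have hq0 : 0 ≤ q := mul_nonneg (hy.1 i) (hy.1 j)
  have := hconv.induction_weight hx hy h h'
    (fun N v => 0 ≤ N ∧ 0 ≤ v i ∧ 0 ≤ v j ∧ N ^ 2 * q ≤ v i * v j) ?_ ?_ ?_
  · simpa using this.2.2.2
  · rintro N v N' v' ⟨h1, h2, h3, h4⟩ ⟨h1', h2', h3', h4'⟩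
    refine ⟨add_nonneg h1 h1', add_nonneg h2 h2', add_nonneg h3 h3', ?_⟩
    -- AM-GM for the cross terms, followed by the product of the two given inequalities.
    have h5 : (2 * (N * N' * q)) ^ 2 ≤ (v i * v' j + v' i * v j) ^ 2 := by
      have := mul_le_mul h4 h4' (by positivity) (mul_nonneg h2 h3)
      nlinarith [sq_nonneg (v i * v' j - v' i * v j)]
    have h6 := abs_le_of_sq_le_sq h5
      (add_nonneg (mul_nonneg h2 h3') (mul_nonneg h2' h3))
    have h7 := (abs_le.1 h6).2
    simp only [Pi.add_apply]
    nlinarith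
  · rintro N v v' ⟨h1, h2, h3, h4⟩ hle
    exact ⟨h1, h2.trans (hle i), h3.trans (hle j),
      h4.trans (mul_le_mul (hle i) (hle j) h3 (h2.trans (hle i)))⟩
  · exact fun N v hN hv hprod => ⟨hN, hv i, hv j, (hprod i j hij).ge⟩

/-! ### Equivalence of parameter vectors supported on two parties -/

/-- The rotation of the plane by a complex number of modulus one. -/
def rotation (u : ℂ) : Matrix (Fin 2) (Fin 2) ℂ := !![u.re, -u.im; u.im, u.re]

lemma rotation_mem_unitaryGroup {u : ℂ} (hu : ‖u‖ = 1) :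
    rotation u ∈ Matrix.unitaryGroup (Fin 2) ℂ := by
  have h : (u.re : ℂ) * u.re + u.im * u.im = 1 := by
    have := Complex.normSq_apply u
    rw [← Complex.sq_norm, hu] at this
    exact_mod_cast (by linarith : u.re * u.re + u.im * u.im = 1)
  rw [Matrix.mem_unitaryGroup_iff]
  ext s t
  fin_cases s <;> fin_cases t <;>
    simp [rotation, Matrix.mul_apply, Fin.sum_univ_two, Matrix.star_apply] <;>
    first | linear_combination h | ring

lemma exists_norm_one_mul_eq {z z' : ℂ} (h : ‖z‖ = ‖z'‖) : ∃ s : ℂ, ‖s‖ = 1 ∧ s * z = z' := by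
  by_cases hz : z = 0
  · subst hz
    refine ⟨1, norm_one, ?_⟩
    rw [norm_zero] at h
    rw [mul_zero, norm_eq_zero.1 h.symm]
  · refine ⟨z' / z, ?_, div_mul_cancel₀ _ hz⟩
    rw [norm_div, ← h, div_self (norm_ne_zero_iff.2 hz)]

/-- Two matrices `!![A, C; B, 0]` with the same norm and the same determinant are equivalent under
rotations. -/
lemma exists_rotation {A B C A' B' C' : ℝ}
    (hnorm : A ^ 2 + B ^ 2 + C ^ 2 = A' ^ 2 + B' ^ 2 + C' ^ 2) (hdet : B * C = B' * C') :
    ∃ u v : ℂ, ‖u‖ = 1 ∧ ‖v‖ = 1 ∧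
      rotation u * !![(A : ℂ), C; B, 0] * (rotation v).transpose = !![(A' : ℂ), C'; B', 0] := by
  -- The matrix is encoded by the complex numbers `A + (B - C) i` and `A + (B + C) i`, which the
  -- rotations multiply by `u * conj v` and `u * v`. Norm and determinant fix their moduli, so unit
  -- factors `s` and `t` exist.
  obtain ⟨s, hs, hs'⟩ : ∃ s : ℂ, ‖s‖ = 1 ∧ s * ⟨A, B - C⟩ = ⟨A', B' - C'⟩ :=
    exists_norm_one_mul_eq <| (sq_eq_sq₀ (norm_nonneg _) (norm_nonneg _)).1 <| by
      rw [Complex.sq_norm, Complex.sq_norm, Complex.normSq_mk, Complex.normSq_mk]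
      linear_combination hnorm - 2 * hdet
  obtain ⟨t, ht, ht'⟩ : ∃ s : ℂ, ‖s‖ = 1 ∧ s * ⟨A, B + C⟩ = ⟨A', B' + C'⟩ :=
    exists_norm_one_mul_eq <| (sq_eq_sq₀ (norm_nonneg _) (norm_nonneg _)).1 <| by
      rw [Complex.sq_norm, Complex.sq_norm, Complex.normSq_mk, Complex.normSq_mk]
      linear_combination hnorm + 2 * hdet
  -- Solves `u * conj v = s` and `u * v = t` with `u ^ 2 = s * t` and `v = conj s * u`.
  obtain ⟨u, hu⟩ := IsAlgClosed.exists_pow_nat_eq (s * t) two_pos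
  have hu1 : ‖u‖ = 1 := by
    have : ‖u‖ ^ 2 = 1 := by rw [← norm_pow, hu, norm_mul, hs, ht, one_mul]
    rwa [pow_eq_one_iff_of_nonneg (norm_nonneg u) two_ne_zero] at this
  obtain ⟨v, hv⟩ : ∃ v, v = (starRingEnd ℂ) s * u := ⟨_, rfl⟩
  have hv1 : ‖v‖ = 1 := by rw [hv, norm_mul, RCLike.norm_conj, hs, hu1, one_mul]
  have hss : s * (starRingEnd ℂ) s = 1 := by rw [Complex.mul_conj', hs]; simp
  have huu : u * (starRingEnd ℂ) u = 1 := by rw [Complex.mul_conj', hu1]; simp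
  have e1 : u * (starRingEnd ℂ) v * ⟨A, B - C⟩ = ⟨A', B' - C'⟩ := by
    rw [← hs', hv, map_mul, Complex.conj_conj]
    linear_combination s * ⟨A, B - C⟩ * huu
  have e2 : u * v * ⟨A, B + C⟩ = ⟨A', B' + C'⟩ := by
    rw [← ht', hv]
    linear_combination (starRingEnd ℂ) s * ⟨A, B + C⟩ * hu + t * ⟨A, B + C⟩ * hss
  refine ⟨u, v, hu1, hv1, ?_⟩
  have r1 := congrArg Complex.re e1
  have i1 := congrArg Complex.im e1
  have r2 := congrArg Complex.re e2
  have i2 := congrArg Complex.im e2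
  simp only [Complex.mul_re, Complex.mul_im, Complex.conj_re, Complex.conj_im] at r1 i1 r2 i2
  ext m n
  fin_cases m <;> fin_cases n <;>
    simp [rotation, Matrix.mul_apply, Fin.sum_univ_two] <;> norm_cast
  · linear_combination (r1 + r2) / 2
  · linear_combination (i2 - i1) / 2
  · linear_combination (i2 + i1) / 2
  · linear_combination (r1 - r2) / 2

/-- The qubit states `|0⟩` of all parties. -/
noncomputable def ket0 : Fin p → Fin 2 → ℂ := fun _ => (EuclideanSpace.single 0 (1 : ℂ)).ofLp

/-- The qubit states `|1⟩` of all parties. -/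
noncomputable def ket1 : Fin p → Fin 2 → ℂ := fun _ => (EuclideanSpace.single 1 (1 : ℂ)).ofLp

lemma Phi_eq (x : Fin p → ℝ) : Phi x = coordVec (d := fun _ => 2) x ket0 ket1 :=
  wVec_eq_tang _ _ _

lemma isCoordFrame_ket : IsCoordFrame (d := fun _ : Fin p => 2) ket0 ket1 := fun k => by
  simp [ket0, ket1, nsq]

lemma tmap_coordVec (A : ∀ k, Matrix (Fin (d' k)) (Fin (d k)) ℂ) (x : Fin p → ℝ)
    (a b : ∀ k, Fin (d k) → ℂ) :
    tmap A (coordVec x a b) =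
      coordVec x (fun k => (A k).mulVec (a k)) fun k => (A k).mulVec (b k) := by
  rw [coordVec, tmap_tang, coordVec]
  simp only [Matrix.mulVec_smul]

lemma tang_apply_of_support {i j : Fin p} (hij : i ≠ j) (c₀ : ℂ) {a b : ∀ k, Fin (d k) → ℂ}
    (hb : ∀ k, k ≠ i → k ≠ j → b k = 0) (t : ∀ k, Fin (d k)) :
    tang c₀ a b t = (∏ m ∈ (univ.erase i).erase j, a m (t m)) *
      (c₀ * a i (t i) * a j (t j) + b i (t i) * a j (t j) + a i (t i) * b j (t j)) := by
  have hsplit : ∀ v : ∀ k, Fin (d k) → ℂ, prodVec v t =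
      v i (t i) * v j (t j) * ∏ m ∈ (univ.erase i).erase j, v m (t m) := fun v => by
    have := prodVec_update_update hij v t (t i) (t j)
    rwa [update_eq_self, update_eq_self] at this
  have h1 : ∏ m ∈ (univ.erase i).erase j, update a i (b i) m (t m) =
      ∏ m ∈ (univ.erase i).erase j, a m (t m) :=
    prod_congr rfl fun m hm => by rw [update_of_ne (ne_of_mem_erase (mem_of_mem_erase hm))]
  have h2 : ∏ m ∈ (univ.erase i).erase j, update a j (b j) m (t m) =
      ∏ m ∈ (univ.erase i).erase j, a m (t m) :=
    prod_congr rfl fun m hm => by rw [update_of_ne (ne_of_mem_erase hm)]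
  have h3 : ∑ n, prodVec (update a n (b n)) =
      prodVec (update a i (b i)) + prodVec (update a j (b j)) := by
    refine Fintype.sum_eq_add i j hij fun n hn => ?_
    funext s
    rw [hb n hn.1 hn.2, prodVec_update_apply]
    simp
  rw [tang, h3]
  simp only [Pi.add_apply, Pi.smul_apply, smul_eq_mul]
  rw [hsplit, hsplit, hsplit, h1, h2, update_self, update_self, update_of_ne hij,
    update_of_ne hij.symm]
  ring

lemma paramEquiv_refl {x : Fin p → ℝ} (hx : x ∈ paramSimplex p) : ParamEquiv x x :=
  ⟨hx, hx, fun _ => 1, fun _ => one_mem _, tmap_one _⟩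

/-- Parameter vectors of bipartite entangled states with the same concurrence are equivalent. -/
lemma paramEquiv_of_mul_eq_mul {i j : Fin p} (hij : i ≠ j) {x y : Fin p → ℝ}
    (hx : x ∈ paramSimplex p) (hy : y ∈ paramSimplex p)
    (hx0 : ∀ k, k ≠ i → k ≠ j → x k = 0) (hy0 : ∀ k, k ≠ i → k ≠ j → y k = 0)
    (h : x i * x j = y i * y j) : ParamEquiv x y := by
  have hz : ∀ {w : Fin p → ℝ}, w ∈ paramSimplex p → (∀ k, k ≠ i → k ≠ j → w k = 0) →
      Real.sqrt (zeroth w) ^ 2 + Real.sqrt (w i) ^ 2 + Real.sqrt (w j) ^ 2 = 1 := by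
    intro w hw hw0
    rw [Real.sq_sqrt (zeroth_nonneg hw), Real.sq_sqrt (hw.1 i), Real.sq_sqrt (hw.1 j), zeroth,
      Fintype.sum_eq_add i j hij fun k hk => hw0 k hk.1 hk.2]
    ring
  have hdet : Real.sqrt (x i) * Real.sqrt (x j) = Real.sqrt (y i) * Real.sqrt (y j) := by
    rw [← Real.sqrt_mul (hx.1 i), ← Real.sqrt_mul (hy.1 i), h]
  obtain ⟨u, v, hu, hv, huv⟩ := exists_rotation ((hz hx hx0).trans (hz hy hy0).symm) hdet
  let U : Fin p → Matrix (Fin 2) (Fin 2) ℂ := fun k =>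
    if k = i then rotation u else if k = j then rotation v else 1
  have hUi : U i = rotation u := if_pos rfl
  have hUj : U j = rotation v := by simp [U, hij.symm]
  refine ⟨hx, hy, U, fun k => ?_, ?_⟩
  · simp only [U]
    split_ifs
    · exact rotation_mem_unitaryGroup hu
    · exact rotation_mem_unitaryGroup hv
    · exact one_mem _
  · change tmap (d := fun _ => 2) (d' := fun _ => 2) U (Phi x) = Phi y
    rw [Phi_eq, Phi_eq, tmap_coordVec, coordVec, coordVec]
    funext t
    rw [tang_apply_of_support hij _ (fun k h1 h2 => by simp [hx0 k h1 h2]),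
      tang_apply_of_support hij _ (fun k h1 h2 => by simp [hy0 k h1 h2])]
    congr 1
    · refine prod_congr rfl fun m hm => ?_
      simp only [mem_erase, mem_univ, and_true] at hm
      simp [U, hm.1, hm.2]
    -- The remaining factor is the `(t i, t j)` entry of the 2 × 2 coefficient matrix of parties `i`
    -- and `j`.
    · have hst := congrFun (congrFun huv (t i)) (t j)
      rw [hUi, hUj]
      revert hst
      generalize t i = s
      generalize t j = r
      fin_cases s <;> fin_cases r <;>
      · simp only [ket0, ket1, rotation, Matrix.mul_apply, Matrix.mulVec, dotProduct,
          Fin.sum_univ_two, Matrix.transpose_apply, Matrix.of_apply]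
        simp
        intro hst
        linear_combination hst

/-! ### Change of frame between equivalent parameter vectors -/

lemma IsCoordFrame.mulVec {a b : ∀ k, Fin (d k) → ℂ} (h : IsCoordFrame a b)
    {A : ∀ k, Matrix (Fin (d' k)) (Fin (d k)) ℂ} (hA : ∀ k, (A k).conjTranspose * A k = 1) :
    IsCoordFrame (fun k => (A k).mulVec (a k)) fun k => (A k).mulVec (b k) := by
  intro k
  have hdot : ∀ v w, star ((A k).mulVec v) ⬝ᵥ (A k).mulVec w = star v ⬝ᵥ w := fun v w => by
    rw [Matrix.star_mulVec, ← Matrix.dotProduct_mulVec, Matrix.mulVec_mulVec, hA,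
      Matrix.one_mulVec]
  have hnsq : ∀ v, nsq ((A k).mulVec v) = nsq v := fun v => by
    have : ((nsq ((A k).mulVec v) : ℝ) : ℂ) = (nsq v : ℂ) := by
      rw [ofReal_nsq, ofReal_nsq, hdot]
    exact_mod_cast this
  rw [hnsq, hnsq, hdot]
  exact h k

/-- Equivalent parameter vectors are parameter vectors of the same states. -/
lemma ParamEquiv.exists_coordVec_eq {x y : Fin p → ℝ} (hxy : ParamEquiv x y)
    {a b : ∀ k, Fin (d k) → ℂ} (h : IsCoordFrame a b) :
    ∃ a' b', IsCoordFrame a' b' ∧ coordVec x a b = coordVec (d := d) y a' b' := by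
  obtain ⟨_, _, U, hU, hUxy⟩ := hxy
  change tmap (d := fun _ => 2) (d' := fun _ => 2) U (Phi x) = Phi y at hUxy
  -- The isometry from the qubit into the space of party `k` with columns `a k, b k`; the new frame
  -- is the image of the kets under `E k` after the inverse local unitary.
  let E : ∀ k, Matrix (Fin (d k)) (Fin 2) ℂ := fun k => Matrix.of fun s t => ![a k s, b k s] t
  have hE : ∀ k, (E k).conjTranspose * E k = 1 := fun k => by
    obtain ⟨h1, h2, h3, h4⟩ := h.star_dotProduct_eq k
    ext s t
    fin_cases s <;> fin_cases t
    · simpa [E, Matrix.mul_apply, dotProduct] using h1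
    · simpa [E, Matrix.mul_apply, dotProduct] using h3
    · simpa [E, Matrix.mul_apply, dotProduct] using h4
    · simpa [E, Matrix.mul_apply, dotProduct] using h2
  have hinv : tmap (d := fun _ => 2) (d' := fun _ => 2) (fun k => star (U k)) (Phi y) = Phi x := by
    rw [← hUxy, tmap_tmap]
    simp only [Matrix.mem_unitaryGroup_iff'.1 (hU _)]
    exact tmap_one _
  have hEx : tmap (d := fun _ => 2) E (Phi x) = coordVec x a b := by
    rw [Phi_eq, tmap_coordVec]
    congr 1 <;> funext k s <;>
      simp [E, ket0, ket1, Matrix.mulVec, dotProduct]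
  rw [← hEx, ← hinv, tmap_tmap, Phi_eq, tmap_coordVec]
  refine ⟨_, _, isCoordFrame_ket.mulVec (fun k => ?_), rfl⟩
  rw [Matrix.conjTranspose_mul, Matrix.mul_assoc, ← Matrix.mul_assoc _ (E k), hE, Matrix.one_mul,
    ← Matrix.star_eq_conjTranspose, star_star, Matrix.mem_unitaryGroup_iff.1 (hU k)]

/-! ### Composition of deterministic conversions -/

/-- Run the protocol `Q` after every branch of a protocol. -/
def Protocol.append : Protocol d → Protocol d → Protocol d
  | .done, Q => Q
  | .measure k n M hM next, Q => .measure k n M hM fun r => (next r).append Q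

lemma Protocol.finalStates_smul (P : Protocol d) :
    ∀ (c : ℂ) (ψ : StateVec d), ∀ χ ∈ P.finalStates (c • ψ),
      ∃ χ' ∈ P.finalStates ψ, χ = c • χ' := by
  induction P with
  | done => rintro c ψ χ rfl; exact ⟨ψ, rfl, rfl⟩
  | measure k n M hM next ih =>
    intro c ψ χ hχ
    obtain ⟨r, hr⟩ := Set.mem_iUnion.1 hχ
    rw [actAt_smul] at hr
    obtain ⟨χ', hχ', rfl⟩ := ih r c _ χ hr
    exact ⟨χ', Set.mem_iUnion.2 ⟨r, hχ'⟩, rfl⟩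

lemma Protocol.mem_finalStates_append (Q P : Protocol d) :
    ∀ ψ : StateVec d, ∀ χ ∈ (P.append Q).finalStates ψ,
      ∃ χ' ∈ P.finalStates ψ, χ ∈ Q.finalStates χ' := by
  induction P with
  | done => exact fun ψ χ hχ => ⟨ψ, rfl, hχ⟩
  | measure k n M hM next ih =>
    intro ψ χ hχ
    obtain ⟨r, hr⟩ := Set.mem_iUnion.1 hχ
    obtain ⟨χ', hχ', h⟩ := ih r _ χ hr
    exact ⟨χ', Set.mem_iUnion.2 ⟨r, hχ'⟩, h⟩

lemma DetLOCC.refl (ψ : StateVec d) : DetLOCC ψ ψ :=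
  ⟨.done, fun χ hχ => ⟨1, by rw [one_smul]; exact hχ⟩⟩

lemma DetLOCC.trans {ψ φ χ : StateVec d} (h1 : DetLOCC ψ φ) (h2 : DetLOCC φ χ) : DetLOCC ψ χ := by
  obtain ⟨P, hP⟩ := h1
  obtain ⟨Q, hQ⟩ := h2
  refine ⟨P.append Q, fun ξ hξ => ?_⟩
  obtain ⟨ξ', hξ', h⟩ := Q.mem_finalStates_append P ψ ξ hξ
  obtain ⟨c, rfl⟩ := hP ξ' hξ'
  obtain ⟨ξ'', hξ'', rfl⟩ := Q.finalStates_smul c φ ξ h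
  obtain ⟨c', rfl⟩ := hQ ξ'' hξ''
  exact ⟨c * c', smul_smul c c' χ⟩

lemma DetLOCC.smul {ψ φ : StateVec d} (h : DetLOCC ψ φ) (c : ℂ) : DetLOCC (c • ψ) φ := by
  obtain ⟨P, hP⟩ := h
  refine ⟨P, fun ξ hξ => ?_⟩
  obtain ⟨ξ', hξ', rfl⟩ := P.finalStates_smul c ψ ξ hξ
  obtain ⟨c', rfl⟩ := hP ξ' hξ'
  exact ⟨c * c', smul_smul c c' φ⟩

lemma DetLOCC.smul_left (ψ : StateVec d) (c : ℂ) : DetLOCC (c • ψ) ψ :=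
  (DetLOCC.refl ψ).smul c

lemma DetLOCC.measure {ψ φ : StateVec d} {k : Fin p} {n : ℕ}
    {M : Fin n → Matrix (Fin (d k)) (Fin (d k)) ℂ} (hM : ∑ r, (M r).conjTranspose * M r = 1)
    (h : ∀ r, DetLOCC (actAt k (M r) ψ) φ) : DetLOCC ψ φ := by
  choose P hP using h
  refine ⟨.measure k n M hM P, fun χ hχ => ?_⟩
  obtain ⟨r, hr⟩ := Set.mem_iUnion.1 hχ
  exact hP r χ hr

lemma update_chain {X : Type*} {R : (Fin p → X) → (Fin p → X) → Prop} (hrefl : ∀ f, R f f)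
    (htrans : ∀ {f g h}, R f g → R g h → R f h) {f g : Fin p → X}
    (hstep : ∀ h k, (∀ m, h m = f m ∨ h m = g m) → h k = f k → R h (update h k (g k))) :
    R f g := by
  classical
  have key : ∀ s : Finset (Fin p), R f fun m => if m ∈ s then g m else f m := by
    intro s
    induction s using Finset.induction_on with
    | empty => simpa using hrefl f
    | insert k s hk ih =>
      refine htrans ih ?_
      have h1 : (fun m => if m ∈ insert k s then g m else f m) =
          update (fun m => if m ∈ s then g m else f m) k (g k) := by
        funext m
        by_cases hm : m = k
        · subst hm
          simp
        · simp [hm]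
      rw [h1]
      refine hstep _ k (fun m => ?_) (by simp [hk])
      by_cases hm : m ∈ s <;> simp [hm]
  simpa using key univ

/-! ### Sufficiency: lowering the parameters one at a time -/

/-- For a unit vector `b`: the operator that maps `b` to `b + η` and fixes the vectors orthogonal to
`b`. -/
def shear {n : ℕ} (b η : Fin n → ℂ) : Matrix (Fin n) (Fin n) ℂ := 1 + Matrix.vecMulVec η (star b)

lemma shear_mulVec {n : ℕ} (b η v : Fin n → ℂ) :
    (shear b η).mulVec v = v + (star b ⬝ᵥ v) • η := by
  rw [shear, Matrix.add_mulVec, Matrix.one_mulVec, Matrix.vecMulVec_mulVec]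
  simp

lemma shear_conjTranspose_mul {n : ℕ} (b η : Fin n → ℂ) :
    (shear b η).conjTranspose * shear b η =
      1 + (Matrix.vecMulVec η (star b) + Matrix.vecMulVec b (star η)) +
        (star η ⬝ᵥ η) • Matrix.vecMulVec b (star b) := by
  rw [shear, Matrix.conjTranspose_add, Matrix.conjTranspose_one, Matrix.conjTranspose_vecMulVec,
    star_star, add_mul, mul_add, mul_add, one_mul, one_mul, mul_one, Matrix.vecMulVec_mul_vecMulVec,
    Matrix.vecMulVec_smul]
  abel

/-- The operator fixes `a k` and sends `b k` to `v • b k + w • a k`; the new `a k` component merges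
with the `c₀` term. -/
lemma actAt_shear_tang {a b : ∀ k, Fin (d k) → ℂ} (h : IsCoordFrame a b) (c₀ : ℂ) (c : Fin p → ℂ)
    (k : Fin p) (v w : ℂ) :
    actAt k (shear (b k) ((v - 1) • b k + w • a k)) (tang c₀ a fun n => c n • b n) =
      tang (c₀ + w * c k) a fun n => update c k (v * c k) n • b n := by
  obtain ⟨h1, h2, h3, h4⟩ := h.star_dotProduct_eq k
  rw [actAt_tang, shear_mulVec, shear_mulVec, h4, dotProduct_smul, h2, zero_smul, add_zero,
    update_eq_self]
  have hn : ∀ n, n ≠ k → prodVec (update a n (update (fun n => c n • b n) k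
      (c k • b k + (c k • (1 : ℂ)) • ((v - 1) • b k + w • a k)) n)) =
      prodVec (update a n (update c k (v * c k) n • b n)) := fun n hn => by
    rw [update_of_ne hn, update_of_ne hn]
  have hk : c k • b k + (c k • (1 : ℂ)) • ((v - 1) • b k + w • a k) =
      (v * c k) • b k + (w * c k) • a k := by
    funext s
    simp only [Pi.add_apply, Pi.smul_apply, smul_eq_mul]
    ring
  rw [tang, tang, ← add_sum_erase _ _ (mem_univ k),
    sum_congr rfl fun n hn' => hn n (ne_of_mem_erase hn'), ← add_sum_erase univ (fun n =>
      prodVec (update a n (update c k (v * c k) n • b n))) (mem_univ k), update_self, update_self,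
      hk, prodVec_update_add, prodVec_update_smul _ _ (w * c k), update_eq_self, add_smul]
  abel

/-- A local phase change. -/
lemma detLOCC_phase {a b : ∀ k, Fin (d k) → ℂ} (h : IsCoordFrame a b) (c₀ : ℂ) (c : Fin p → ℂ)
    {ω : ℂ} (hω : ‖ω‖ = 1) :
    DetLOCC (tang c₀ a fun n => c n • b n) (tang c₀ a fun n => (ω * c n) • b n) := by
  refine update_chain (R := fun c c' : Fin p → ℂ =>
    DetLOCC (tang c₀ a fun n => c n • b n) (tang c₀ a fun n => c' n • b n))
    (fun _ => .refl _) .trans (f := c) (g := fun n => ω * c n) fun e k _ hk => ?_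
  refine DetLOCC.measure (k := k) (n := 1)
    (M := fun _ => shear (b k) ((ω - 1) • b k + (0 : ℂ) • a k)) ?_ fun _ => ?_
  · obtain ⟨h1, h2, h3, h4⟩ := h.star_dotProduct_eq k
    have hω' : (starRingEnd ℂ) ω * ω = 1 := by rw [Complex.conj_mul', hω]; simp
    rw [Fin.sum_univ_one, shear_conjTranspose_mul, zero_smul, add_zero, star_smul, smul_dotProduct,
      dotProduct_smul, h2, Matrix.vecMulVec_smul, Matrix.smul_vecMulVec, ← add_smul, add_assoc,
      ← add_smul]
    convert add_zero (1 : Matrix (Fin (d k)) (Fin (d k)) ℂ)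
    convert zero_smul ℂ (Matrix.vecMulVec (b k) (star (b k)))
    simp only [smul_eq_mul, mul_one, star_sub, star_one, RCLike.star_def]
    linear_combination hω'
  · rw [actAt_shear_tang h, zero_mul, add_zero, hk]
    exact .refl _

/-- One parameter can be decreased with certainty. -/
lemma detLOCC_update {x : Fin p → ℝ} (hx : x ∈ paramSimplex p) {a b : ∀ k, Fin (d k) → ℂ}
    (h : IsCoordFrame a b) {k : Fin p} {t : ℝ} (ht0 : 0 ≤ t) (ht : t ≤ x k) :
    DetLOCC (coordVec x a b) (coordVec (update x k t) a b) := by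
  rcases (hx.1 k).eq_or_lt with hk | hk
  · have : t = x k := le_antisymm ht (hk ▸ ht0)
    rw [this, update_eq_self]
    exact .refl _
  set v := Real.sqrt (t / x k)
  set s := Real.sqrt (1 - t / x k)
  have hdiv : t / x k ≤ 1 := (div_le_one hk).2 ht
  have hv2 : v ^ 2 = t / x k := Real.sq_sqrt (div_nonneg ht0 hk.le)
  have hs2 : s ^ 2 = 1 - t / x k := Real.sq_sqrt (sub_nonneg.2 hdiv)
  have hvx : v * Real.sqrt (x k) = Real.sqrt t := by
    rw [← Real.sqrt_mul (div_nonneg ht0 hk.le), div_mul_cancel₀ _ hk.ne']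
  let μ : ℂ := (Real.sqrt 2 : ℂ)⁻¹
  have hμ : star μ * μ = 1 / 2 := by
    have : ((Real.sqrt 2 : ℝ) : ℂ) * (Real.sqrt 2 : ℝ) = 2 := by
      rw [← Complex.ofReal_mul, Real.mul_self_sqrt zero_le_two, Complex.ofReal_ofNat]
    simp only [μ, star_inv₀, RCLike.star_def, Complex.conj_ofReal, ← mul_inv, this]
    norm_num
  let ε : Fin 2 → ℝ := ![1, -1]
  have hε : ∀ r, ε r ^ 2 = 1 := fun r => by fin_cases r <;> simp [ε]
  -- The outcomes send `b k` to `v • b k ± (i * s) • a k`. The opposite signs cancel the cross terms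
  -- and `v ^ 2 + s ^ 2 = 1` gives completeness. The factor `i` gives both new zeroth coefficients
  -- the squared modulus `zeroth x + s ^ 2 * x k`.
  let η : Fin 2 → Fin (d k) → ℂ := fun r => ((v : ℂ) - 1) • b k + ((ε r * s : ℝ) * Complex.I) • a k
  refine DetLOCC.measure (k := k) (n := 2) (M := fun r => μ • shear (b k) (η r)) ?_ fun r => ?_
  · obtain ⟨h1, h2, h3, h4⟩ := h.star_dotProduct_eq k
    have hη : ∀ r, star (η r) ⬝ᵥ η r = (((v - 1) ^ 2 + s ^ 2 : ℝ) : ℂ) := fun r => by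
      simp only [η, star_add, star_smul, add_dotProduct, dotProduct_add, smul_dotProduct,
        dotProduct_smul, h1, h2, h3, h4]
      have : ((ε r : ℝ) : ℂ) ^ 2 = 1 := by exact_mod_cast hε r
      simp
      linear_combination (s : ℂ) ^ 2 * this - (ε r : ℂ) ^ 2 * (s : ℂ) ^ 2 * Complex.I_sq
    have hvs : (v : ℂ) ^ 2 + (s : ℂ) ^ 2 = 1 := by
      exact_mod_cast (by rw [hv2, hs2]; ring : v ^ 2 + s ^ 2 = 1)
    have hm : ∀ r, (μ • shear (b k) (η r)).conjTranspose * (μ • shear (b k) (η r)) =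
        (1 / 2 : ℂ) • ((shear (b k) (η r)).conjTranspose * shear (b k) (η r)) := fun r => by
      rw [Matrix.conjTranspose_smul, Matrix.smul_mul, Matrix.mul_smul, smul_smul, hμ]
    simp only [hm, shear_conjTranspose_mul, hη, Fin.sum_univ_two]
    ext m n
    simp only [η, ε, Matrix.add_apply, Matrix.smul_apply, Matrix.vecMulVec_apply, Pi.add_apply,
      Pi.smul_apply, Pi.star_apply, smul_eq_mul, star_add, star_mul', RCLike.star_def]
    simp
    linear_combination (b k m * (starRingEnd ℂ) (b k n)) * hvs
  · rw [smul_actAt]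
    refine DetLOCC.smul ?_ μ
    rw [coordVec, actAt_shear_tang h _ (fun n => (Real.sqrt (x n) : ℂ))]
    set z : ℂ := Real.sqrt (zeroth x) + (ε r * s : ℝ) * Complex.I * Real.sqrt (x k) with hz
    have hnorm : ‖z‖ = ‖((Real.sqrt (zeroth (update x k t)) : ℝ) : ℂ)‖ := by
      have hzero : zeroth (update x k t) = zeroth x + (x k - t) := by
        rw [zeroth, zeroth, sum_update_of_mem (mem_univ k), ← add_sum_erase _ x (mem_univ k),
          sdiff_singleton_eq_erase]
        ring
      rw [← sq_eq_sq₀ (norm_nonneg _) (norm_nonneg _), Complex.norm_real, Real.norm_eq_abs, sq_abs,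
        Real.sq_sqrt, hzero, Complex.sq_norm, Complex.normSq_apply]
      · simp only [hz, Complex.add_re, Complex.add_im, Complex.mul_re, Complex.mul_im,
          Complex.ofReal_re, Complex.ofReal_im, Complex.I_re, Complex.I_im]
        have e1 := Real.sq_sqrt (zeroth_nonneg hx)
        have e2 := Real.sq_sqrt hk.le
        have e3 : s ^ 2 * x k = x k - t := by rw [hs2]; field_simp
        linear_combination e1 + s ^ 2 * Real.sqrt (x k) ^ 2 * hε r + s ^ 2 * e2 + e3
      · rw [hzero]
        exact add_nonneg (zeroth_nonneg hx) (sub_nonneg.2 ht)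
    -- The phase of the zeroth coefficient is copied onto all other terms by local unitaries and
    -- becomes global.
    obtain ⟨ω, hω, hωz⟩ := exists_norm_one_mul_eq hnorm.symm
    have hc : ∀ n, update (fun n => (Real.sqrt (x n) : ℂ)) k (v * (Real.sqrt (x k) : ℂ)) n =
        Real.sqrt (update x k t n) := fun n => by
      by_cases hn : n = k
      · subst hn
        rw [update_self, update_self, ← hvx, Complex.ofReal_mul]
      · rw [update_of_ne hn, update_of_ne hn]
    simp only [hc]
    refine (detLOCC_phase h z _ hω).trans ?_
    convert DetLOCC.smul_left (coordVec (update x k t) a b) ω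
    rw [coordVec, tang, tang, smul_add, smul_smul, hωz, smul_sum]
    simp only [mul_smul, prodVec_update_smul]

lemma detLOCC_of_le {x y : Fin p → ℝ} (hx : x ∈ paramSimplex p) (hy : y ∈ paramSimplex p)
    {a b : ∀ k, Fin (d k) → ℂ} (h : IsCoordFrame a b) (hyx : ∀ k, y k ≤ x k) :
    DetLOCC (coordVec x a b) (coordVec y a b) := by
  refine update_chain (R := fun x y => DetLOCC (coordVec x a b) (coordVec y a b))
    (fun _ => .refl _) .trans fun z k hz hk => ?_
  refine detLOCC_update ⟨fun m => ?_, (sum_le_sum fun m _ => ?_).trans hx.2⟩ h (hy.1 k) ?_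
  · rcases hz m with hm | hm <;> rw [hm]
    exacts [hx.1 m, hy.1 m]
  · rcases hz m with hm | hm <;> rw [hm]
    exact hyx m
  · rw [hk]
    exact hyx k

end WType

theorem theorem2 {p : ℕ} (hp : 3 ≤ p) (d : Fin p → ℕ) (x y : Fin p → ℝ)
    (hy : y ∈ WType.paramSimplex p)
    (ψ : WType.StateVec d) (hW : WType.IsWType ψ) (hψ : WType.HasParam ψ x) :
    (WType.ConvertibleTo ψ y ↔ ∃ y' : Fin p → ℝ, WType.ParamEquiv y' y ∧ ∀ k, y' k ≤ x k) ∧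
    (3 ≤ (Finset.univ.filter (fun k => y k ≠ 0)).card →
      (WType.ConvertibleTo ψ y ↔ ∀ k, y k ≤ x k)) := by
  open WType in
  obtain ⟨hx, a, b, hab, rfl⟩ := (hasParam_iff _ _).1 hψ
  have hback : ∀ y', ParamEquiv y' y → (∀ k, y' k ≤ x k) →
      ConvertibleTo (coordVec x a b) y := by
    intro y' hy' hle
    obtain ⟨a', b', hab', heq⟩ := hy'.exists_coordVec_eq hab
    exact ⟨_, (hasParam_iff _ _).2 ⟨hy, a', b', hab', heq⟩, detLOCC_of_le hx hy'.1 hab hle⟩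
  have hthree : 3 ≤ (Finset.univ.filter (fun k => y k ≠ 0)).card →
      ConvertibleTo (coordVec x a b) y → ∀ k, y k ≤ x k := by
    rintro hcard ⟨φ, hφ, hconv⟩
    obtain ⟨-, a', b', hab', rfl⟩ := (hasParam_iff _ _).1 hφ
    exact le_of_detLOCC hx hy hab hab' hconv hcard
  refine ⟨⟨fun hconv => ?_, fun ⟨y', hy', hle⟩ => hback y' hy' hle⟩,
    fun hcard => ⟨hthree hcard, hback y (paramEquiv_refl hy)⟩⟩
  by_cases hcard : 3 ≤ (Finset.univ.filter (fun k => y k ≠ 0)).card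
  · exact ⟨y, paramEquiv_refl hy, hthree hcard hconv⟩
  obtain ⟨i, j, hij, hy0⟩ := exists_pair_of_card_filter_lt hp hcard
  obtain ⟨φ, hφ, hconv⟩ := hconv
  obtain ⟨-, a', b', hab', rfl⟩ := (hasParam_iff _ _).1 hφ
  have hmul := mul_le_mul_of_detLOCC hx hy hab hab' hconv hij
  -- Keep `x j` at `j` and lower `x i` to `y i * y j / x j`, which is possible by `hmul`. If `x j =
  -- 0`, the product of the target vanishes and `y' = 0` works.
  obtain ⟨y', hy'0, hle, hsupp, hprod⟩ : ∃ y' : Fin p → ℝ, (∀ k, 0 ≤ y' k) ∧ (∀ k, y' k ≤ x k) ∧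
      (∀ k, k ≠ i → k ≠ j → y' k = 0) ∧ y' i * y' j = y i * y j := by
    by_cases hxj : x j = 0
    · refine ⟨0, fun _ => le_rfl, hx.1, fun _ _ _ => rfl, ?_⟩
      rw [hxj, mul_zero] at hmul
      simpa using (le_antisymm hmul (mul_nonneg (hy.1 i) (hy.1 j))).symm
    · have hxj' : 0 < x j := lt_of_le_of_ne (hx.1 j) (Ne.symm hxj)
      have hq : 0 ≤ y i * y j / x j := div_nonneg (mul_nonneg (hy.1 i) (hy.1 j)) hxj'.le
      refine ⟨fun k => if k = i then y i * y j / x j else if k = j then x j else 0,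
        fun k => ?_, fun k => ?_, fun k h1 h2 => by simp [h1, h2], ?_⟩
      · dsimp only
        split_ifs
        exacts [hq, hxj'.le, le_rfl]
      · dsimp only
        split_ifs with h1 h2
        · rw [h1]
          exact (div_le_iff₀ hxj').2 hmul
        · rw [h2]
        · exact hx.1 k
      · simp [hij.symm, hxj]
  exact ⟨y', paramEquiv_of_mul_eq_mul hij
    ⟨hy'0, (Finset.sum_le_sum fun k _ => hle k).trans hx.2⟩ hy hsupp hy0 hprod, hle⟩
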